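/- Let $\mathbb{F}$ be a field, let $N \ge 1$ and $d \ge 0$ be integers, let $E = \mathbb{F}^2$ be the natural representation of $\mathrm{GL}_2(\mathbb{F})$, and fix a basis $X, Y$ of $E$. For $c \ge 0$ the symmetric power $\mathrm{Sym}^c E$ (the degree $c$ part of the symmetric algebra of $E$) has the basis $X^{c-i}Y^i$, $0 \le i \le c$. For a vector space $V$ let $$\Delta^{(2,1^{N-1})} V = \ker\bigl(\mu_N : \textstyle\bigwedge^N V \otimes V \to \bigwedge^{N+1} V\bigr), \qquad \mu_N(v_1 \wedge \cdots \wedge v_N \otimes w) = v_1 \wedge \cdots \wedge v_N \wedge w ;$$ if $V$ is a representation of a group, then $\Delta^{(2,1^{N-1})} V$ is a subrepresentation of $\bigwedge^N V \otimes V$. Let $\det$ be the one-dimensional determinant representation of $\mathrm{GL}_2(\mathbb{F})$. For a tuple $\mathbf{i} = (i_1, \ldots, i_r)$ with entries in $\{0, \ldots, c\}$ put $|\mathbf{i}| = i_1 + \cdots + i_r$ and $F^{(c)}_\wedge(\mathbf{i}) = X^{c-i_1}Y^{i_1} \wedge \cdots \wedge X^{c-i_r}Y^{i_r} \in \bigwedge^r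 \mathrm{Sym}^c E$. Let $$\phi : \mathrm{Sym}^{N-1} E \otimes \textstyle\bigwedge^{N+1} \mathrm{Sym}^{d+1} E \to \bigwedge^N \mathrm{Sym}^d E \otimes \mathrm{Sym}^d E$$ be the linear map defined on the canonical basis by $$\phi\bigl(X^{N-1-s}Y^s \otimes F^{(d+1)}_\wedge(\mathbf{k})\bigr) = \sum_{\mathbf{i} \in [k_1,k_2) \times \cdots \times [k_N, k_{N+1})} F^{(d)}_\wedge(\mathbf{i}) \otimes X^{d-j(\mathbf{i})}Y^{j(\mathbf{i})}, \qquad j(\mathbf{i}) = s + |\mathbf{k}| - N - |\mathbf{i}|,$$ for $0 \le s \le N-1$ and $0 \le k_1 < \cdots < k_{N+1} \le d+1$, where $[a,b) = \{a, a+1, \ldots, b-1\}$ (one has $0 \le j(\mathbf{i}) \le d$ for every $\mathbf{i}$ in the sum). Then the image of $\phi$ is contained in $\Delta^{(2,1^{N-1})} \mathrm{Sym}^d E$, and $\phi$ (that is, $x \mapsto 1 \otimes \phi(x)$) is an isomorphism of representations of $\mathrm{GL}_2(\mathbb{F})$ $$\mathrm{Sym}^{N-1} E \otimes \textstyle\bigwedge^{N+1}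 \mathrm{Sym}^{d+1} E \;\cong\; \det^N \otimes\, \Delta^{(2,1^{N-1})} \mathrm{Sym}^d E .$$ -/

import Mathlib

open scoped TensorProduct ExteriorAlgebra MatrixGroups

noncomputable section

namespace Plethysm

universe u v w

section SymmetricPower

variable (F : Type u) [Field F]

/-- The symmetric power `Sym^r V`: the degree `r` part of the symmetric algebra of `V`
(the quotient of the tensor algebra by `x ⊗ y - y ⊗ x`), that is, the span of the `r`-fold
products of vectors of `V`. -/
abbrev SymPow (r : ℕ) (V : Type v) [AddCommGroup V] [Module F V] :
    Submodule F (SymmetricAlgebra F V) :=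
  LinearMap.range (SymmetricAlgebra.ι F V) ^ r

variable {F} {V : Type v} [AddCommGroup V] [Module F V] {W : Type w} [AddCommGroup W] [Module F W]

theorem symMap_mem (r : ℕ) (f : V →ₗ[F] W) (x : SymmetricAlgebra F V) (hx : x ∈ SymPow F r V) :
    (SymmetricAlgebra.lift (SymmetricAlgebra.ι F W ∘ₗ f)).toLinearMap x ∈ SymPow F r W := by
  have h := Submodule.mem_map_of_mem
    (f := (SymmetricAlgebra.lift (SymmetricAlgebra.ι F W ∘ₗ f)).toLinearMap) hx
  rw [Submodule.map_pow] at h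
  have hle : (LinearMap.range (SymmetricAlgebra.ι F V)).map
      (SymmetricAlgebra.lift (SymmetricAlgebra.ι F W ∘ₗ f)).toLinearMap ≤
        LinearMap.range (SymmetricAlgebra.ι F W) := by
    rintro _ ⟨_, ⟨v, rfl⟩, rfl⟩
    exact ⟨f v, by simp⟩
  exact pow_le_pow_left' hle r h

/-- Functoriality of `Sym^r`: the linear map with `v₁ ⋯ v_r ↦ f v₁ ⋯ f v_r`. -/
def symMap (r : ℕ) (f : V →ₗ[F] W) : SymPow F r V →ₗ[F] SymPow F r W :=
  LinearMap.restrict (SymmetricAlgebra.lift (SymmetricAlgebra.ι F W ∘ₗ f)).toLinearMap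
    (symMap_mem r f)

/-- The representation `Sym^r V` attached to a representation `V`. -/
def symRep {G : Type w} [Monoid G] (r : ℕ) (ρ : Representation F G V) :
    Representation F G (SymPow F r V) where
  toFun g := symMap r (ρ g)
  map_one' := by
    ext x
    have h : SymmetricAlgebra.lift (SymmetricAlgebra.ι F V ∘ₗ (1 : Module.End F V)) =
        AlgHom.id F _ := by
      ext v; simp
    rw [map_one]
    change SymmetricAlgebra.lift (SymmetricAlgebra.ι F V ∘ₗ (1 : Module.End F V)) x.1 = x.1
    rw [h]; rfl
  map_mul' g g' := by
    ext x
    have h : SymmetricAlgebra.lift (SymmetricAlgebra.ι F V ∘ₗ (ρ g * ρ g')) =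
        (SymmetricAlgebra.lift (SymmetricAlgebra.ι F V ∘ₗ ρ g)).comp
          (SymmetricAlgebra.lift (SymmetricAlgebra.ι F V ∘ₗ ρ g')) := by
      ext v; simp
    rw [map_mul]
    change SymmetricAlgebra.lift (SymmetricAlgebra.ι F V ∘ₗ (ρ g * ρ g')) x.1 = _
    rw [h]; rfl

end SymmetricPower

section ExteriorPower

variable {F : Type u} [Field F] {V : Type v} [AddCommGroup V] [Module F V]

/-- The representation `⋀^r V` attached to a representation `V`. -/
def extRep {G : Type w} [Monoid G] (r : ℕ) (ρ : Representation F G V) :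
    Representation F G (⋀[F]^r V) where
  toFun g := exteriorPower.map r (ρ g)
  map_one' := by rw [map_one]; exact exteriorPower.map_id
  map_mul' g g' := by rw [map_mul]; exact exteriorPower.map_comp _ _

variable (F V)

theorem wedge_mem (N : ℕ) (x : ⋀[F]^N V) (v : V) :
    (x : ExteriorAlgebra F V) * ExteriorAlgebra.ι F v ∈ ⋀[F]^(N + 1) V := by
  change _ ∈ LinearMap.range (ExteriorAlgebra.ι F (M := V)) ^ (N + 1)
  rw [pow_succ]
  exact Submodule.mul_mem_mul x.2 ⟨v, rfl⟩

/-- The multiplication map `μ_N : ⋀^N V ⊗ V → ⋀^(N+1) V`,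
`v₁ ∧ ⋯ ∧ v_N ⊗ w ↦ v₁ ∧ ⋯ ∧ v_N ∧ w`. -/
def mu (N : ℕ) : (⋀[F]^N V) ⊗[F] V →ₗ[F] ⋀[F]^(N + 1) V :=
  TensorProduct.lift <| LinearMap.mk₂ F
    (fun x v => ⟨(x : ExteriorAlgebra F V) * ExteriorAlgebra.ι F v, wedge_mem F V N x v⟩)
    (fun x y v => Subtype.ext (by simp [add_mul]))
    (fun c x v => Subtype.ext (by simp))
    (fun x v w => Subtype.ext (by simp [mul_add]))
    (fun c x v => Subtype.ext (by simp))

/-- The Schur functor `Δ^(2,1^(N-1))` on vector spaces: the kernel of `μ_N`. -/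
def Delta (N : ℕ) : Submodule F ((⋀[F]^N V) ⊗[F] V) :=
  LinearMap.ker (mu F V N)

variable {F V}

theorem mu_natural (N : ℕ) (f : V →ₗ[F] V) :
    mu F V N ∘ₗ TensorProduct.map (exteriorPower.map N f) f =
      exteriorPower.map (N + 1) f ∘ₗ mu F V N := by
  have key : ∀ (n : ℕ) (y : ⋀[F]^n V),
      (exteriorPower.map n f y : ExteriorAlgebra F V) = ExteriorAlgebra.map f y := by
    intro n y
    have : (⋀[F]^n V).subtype ∘ₗ exteriorPower.map n f =
        (ExteriorAlgebra.map f).toLinearMap ∘ₗ (⋀[F]^n V).subtype := by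
      ext v
      simp [exteriorPower.map_apply_ιMulti]
    exact LinearMap.congr_fun this y
  refine TensorProduct.ext' fun x v => Subtype.ext ?_
  simp [mu, key]

theorem Delta_le_comap {G : Type w} [Monoid G] (N : ℕ) (ρ : Representation F G V) (g : G) :
    Delta F V N ≤ (Delta F V N).comap (((extRep N ρ).tprod ρ) g) := by
  intro x hx
  have h := LinearMap.congr_fun (mu_natural N (ρ g)) x
  have hx' : mu F V N x = 0 := hx
  change mu F V N (TensorProduct.map (exteriorPower.map N (ρ g)) (ρ g) x) = 0
  simpa [hx'] using h

/-- The representation `Δ^(2,1^(N-1)) V` attached to a representation `V`. -/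
def deltaRep {G : Type w} [Monoid G] (N : ℕ) (ρ : Representation F G V) :
    Representation F G (Delta F V N) :=
  ((extRep N ρ).tprod ρ).subrepresentation (Delta F V N) (Delta_le_comap N ρ)

end ExteriorPower

section GL2

variable (F : Type u) [Field F]

/-- The natural representation `E = F²` of `GL₂(F)`. -/
def natRep : Representation F (GL (Fin 2) F) (Fin 2 → F) where
  toFun g := Matrix.mulVecLin (g : Matrix (Fin 2) (Fin 2) F)
  map_one' := by simp; rfl
  map_mul' g h := by simp [Matrix.mulVecLin_mul]; rfl

/-- The one-dimensional representation `det^N` of `GL₂(F)`. -/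
def detRep (N : ℕ) : Representation F (GL (Fin 2) F) F where
  toFun g := (Matrix.det (g : Matrix (Fin 2) (Fin 2) F) ^ N) • LinearMap.id
  map_one' := by simp; rfl
  map_mul' g h := by
    ext; simp [mul_pow, mul_comm]

end GL2

section Phi

variable {F : Type u} [Field F] {E : Type v} [AddCommGroup E] [Module F E]
  (b : Module.Basis (Fin 2) F E)

theorem monomial_mem {c i : ℕ} (h : i ≤ c) :
    SymmetricAlgebra.ι F E (b 0) ^ (c - i) * SymmetricAlgebra.ι F E (b 1) ^ i ∈ SymPow F c E := by
  have := Submodule.mul_mem_mul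
    (Submodule.pow_mem_pow (LinearMap.range (SymmetricAlgebra.ι F E)) ⟨b 0, rfl⟩ (c - i))
    (Submodule.pow_mem_pow (LinearMap.range (SymmetricAlgebra.ι F E)) ⟨b 1, rfl⟩ i)
  rwa [← pow_add, Nat.sub_add_cancel h] at this

/-- The monomial `X^(c-i) Y^i` in `Sym^c E` for `0 ≤ i ≤ c`, where `X = b 0`, `Y = b 1` is the
chosen basis of `E`. (The value for `i > c` is set to `0` and never matters, see
`exponent_le`.) -/
def monomial (c i : ℕ) : SymPow F c E :=
  if h : i ≤ c then
    ⟨SymmetricAlgebra.ι F E (b 0) ^ (c - i) * SymmetricAlgebra.ι F E (b 1) ^ i, monomial_mem b h⟩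
  else 0

theorem monomial_linearIndependent (c : ℕ) :
    LinearIndependent F (fun i : Fin (c + 1) => monomial b c i) := by
  have h2 : (SymPow F c E).subtype ∘ (fun i : Fin (c + 1) => monomial b c i) =
      b.symmetricAlgebra ∘ (fun i : Fin (c + 1) =>
        Finsupp.single (0 : Fin 2) (c - (i : ℕ)) + Finsupp.single (1 : Fin 2) (i : ℕ)) := by
    funext i
    have hi : (i : ℕ) ≤ c := Nat.lt_succ_iff.1 i.2
    simp only [Function.comp, monomial, hi, dif_pos, Submodule.subtype_apply,
      Module.Basis.symmetricAlgebra, Module.Basis.map_apply, MvPolynomial.coe_basisMonomials]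
    change _ = (SymmetricAlgebra.equivMvPolynomial b).symm _
    rw [AlgEquiv.eq_symm_apply, map_mul, map_pow, map_pow,
      SymmetricAlgebra.equivMvPolynomial_ι_apply, SymmetricAlgebra.equivMvPolynomial_ι_apply,
      MvPolynomial.X_pow_eq_monomial, MvPolynomial.X_pow_eq_monomial, MvPolynomial.monomial_mul,
      one_mul]
  refine LinearIndependent.of_comp (SymPow F c E).subtype ?_
  rw [h2]
  refine b.symmetricAlgebra.linearIndependent.comp _ fun i j hij => ?_
  have := DFunLike.congr_fun hij 1
  simpa [Fin.ext_iff] using this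

open scoped Pointwise in
theorem monomial_span (c : ℕ) :
    ⊤ ≤ Submodule.span F (Set.range (fun i : Fin (c + 1) => monomial b c i)) := by
  have hr : LinearMap.range (SymmetricAlgebra.ι F E) =
      Submodule.span F {SymmetricAlgebra.ι F E (b 0), SymmetricAlgebra.ι F E (b 1)} := by
    rw [LinearMap.range_eq_map, ← b.span_eq, Submodule.map_span]
    congr 1
    ext x
    simp [eq_comm]
  have hs : ∀ (n : ℕ) (x : SymmetricAlgebra F E),
      x ∈ ({SymmetricAlgebra.ι F E (b 0), SymmetricAlgebra.ι F E (b 1)} :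
        Set (SymmetricAlgebra F E)) ^ n →
      ∃ i, i ≤ n ∧
        x = SymmetricAlgebra.ι F E (b 0) ^ (n - i) * SymmetricAlgebra.ι F E (b 1) ^ i := by
    intro n
    induction n with
    | zero => intro x hx; exact ⟨0, le_rfl, by simpa using hx⟩
    | succ n ih =>
      intro x hx
      rw [pow_succ] at hx
      obtain ⟨y, hy, z, hz, rfl⟩ := Set.mem_mul.1 hx
      obtain ⟨i, hi, rfl⟩ := ih y hy
      rcases hz with rfl | hz
      · refine ⟨i, by omega, ?_⟩
        rw [Nat.succ_sub hi, pow_succ]; ring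
      · rw [Set.mem_singleton_iff] at hz
        subst hz
        refine ⟨i + 1, by omega, ?_⟩
        rw [Nat.succ_sub_succ, pow_succ]; ring
  rintro ⟨x, hx⟩ -
  have hx' := hx
  rw [SymPow, hr, Submodule.span_pow] at hx'
  have hle : Submodule.span F (({SymmetricAlgebra.ι F E (b 0), SymmetricAlgebra.ι F E (b 1)} :
        Set (SymmetricAlgebra F E)) ^ c) ≤
      (Submodule.span F (Set.range (fun i : Fin (c + 1) => monomial b c i))).map
        (SymPow F c E).subtype := by
    rw [Submodule.span_le]
    intro y hy
    obtain ⟨i, hi, rfl⟩ := hs c y hy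
    exact ⟨monomial b c i, Submodule.subset_span ⟨⟨i, Nat.lt_succ_of_le hi⟩, rfl⟩,
      by simp [monomial, hi]⟩
  obtain ⟨y, hy, hyx⟩ := hle hx'
  have : y = ⟨x, hx⟩ := Subtype.ext hyx
  exact this ▸ hy

/-- The basis `X^c, X^(c-1) Y, …, Y^c` of `Sym^c E`. -/
def symBasis (c : ℕ) : Module.Basis (Fin (c + 1)) F (SymPow F c E) :=
  Module.Basis.mk (monomial_linearIndependent b c) (monomial_span b c)

/-- `F_∧^(c)(i) = X^(c-i₁) Y^(i₁) ∧ ⋯ ∧ X^(c-i_r) Y^(i_r)`. -/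
def Fwedge (c : ℕ) {r : ℕ} (i : Fin r → ℕ) : ⋀[F]^r (SymPow F c E) :=
  exteriorPower.ιMulti F r fun a => monomial b c (i a)

/-- `F(i, j) = F_∧^(d)(i) ⊗ X^(d-j) Y^j`. -/
def Ftensor (d : ℕ) {N : ℕ} (i : Fin N → ℕ) (j : ℕ) :
    (⋀[F]^N (SymPow F d E)) ⊗[F] (SymPow F d E) :=
  Fwedge b d i ⊗ₜ[F] monomial b d j

/-- The box `B(k) = [k₁, k₂) × [k₂, k₃) × ⋯ × [k_N, k_{N+1})`. -/
def box {N : ℕ} (k : Fin (N + 1) → ℕ) : Finset (Fin N → ℕ) :=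
  Fintype.piFinset fun a => Finset.Ico (k a.castSucc) (k a.succ)

/-- The right-hand side `∑_{i ∈ B(k)} F(i, s + |k| - N - |i|)` of the definition of `φ`. -/
def phiValue (N d s : ℕ) (k : Fin (N + 1) → ℕ) :
    (⋀[F]^N (SymPow F d E)) ⊗[F] (SymPow F d E) :=
  ∑ i ∈ box k, Ftensor b d i (s + ∑ a, k a - N - ∑ a, i a)

/-- For `i` in the box, the exponents occurring in `phiValue` all lie in `{0, …, d}`, and the
subtractions are not truncated. -/
theorem exponent_le {N d s : ℕ} (hs : s + 1 ≤ N) {k : Fin (N + 1) → ℕ}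
    (hd : ∀ a, k a ≤ d + 1) {i : Fin N → ℕ} (hi : i ∈ box k) :
    (∀ a, i a ≤ d) ∧ N + ∑ a, i a ≤ s + ∑ a, k a ∧ s + ∑ a, k a - N - ∑ a, i a ≤ d := by
  simp only [box, Fintype.mem_piFinset, Finset.mem_Ico] at hi
  have h1 : ∑ a, (i a + 1) ≤ ∑ a : Fin N, k a.succ := Finset.sum_le_sum fun a _ => (hi a).2
  have h2 : ∑ a : Fin N, k a.castSucc ≤ ∑ a, i a := Finset.sum_le_sum fun a _ => (hi a).1
  have h3 := Fin.sum_univ_succ k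
  have h4 := Fin.sum_univ_castSucc k
  have h5 := hd (Fin.last N)
  rw [Finset.sum_add_distrib] at h1
  simp only [Finset.sum_const, Finset.card_univ, Fintype.card_fin, smul_eq_mul, mul_one] at h1
  refine ⟨fun a => ?_, ?_, ?_⟩
  · have := (hi a).2
    have := hd a.succ
    omega
  · omega
  · omega

/-- The linear map `φ : Sym^(N-1) E ⊗ ⋀^(N+1) Sym^(d+1) E → ⋀^N Sym^d E ⊗ Sym^d E`, defined on
the canonical basis by `φ (X^(N-1-s) Y^s ⊗ F_∧^(d+1)(k)) = ∑_{i ∈ B(k)} F(i, s + |k| - N - |i|)`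
for `0 ≤ s ≤ N-1` and `k` strictly increasing; see `phi_apply`. -/
def phi (N d : ℕ) :
    (SymPow F (N - 1) E) ⊗[F] (⋀[F]^(N + 1) (SymPow F (d + 1) E)) →ₗ[F]
      (⋀[F]^N (SymPow F d E)) ⊗[F] (SymPow F d E) :=
  ((symBasis b (N - 1)).tensorProduct ((symBasis b (d + 1)).exteriorPower (N + 1))).constr F
    fun p => phiValue b N d p.1 fun a => (Set.powersetCard.ofFinEmbEquiv.symm p.2 a : ℕ)

theorem phi_apply {N d s : ℕ} (hs : s ≤ N - 1) {k : Fin (N + 1) → ℕ} (hk : StrictMono k)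
    (hd : ∀ a, k a ≤ d + 1) :
    phi b N d (monomial b (N - 1) s ⊗ₜ[F] Fwedge b (d + 1) k) =
      ∑ i ∈ box k, Ftensor b d i (s + ∑ a, k a - N - ∑ a, i a) := by
  let k' : Fin (N + 1) ↪o Fin (d + 1 + 1) :=
    OrderEmbedding.ofStrictMono (fun a => ⟨k a, Nat.lt_succ_of_le (hd a)⟩) fun a a' h => hk h
  have e1 : monomial b (N - 1) s = symBasis b (N - 1) ⟨s, Nat.lt_succ_of_le hs⟩ := by
    rw [symBasis, Module.Basis.mk_apply]
  have e2 : Fwedge b (d + 1) k =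
      (symBasis b (d + 1)).exteriorPower (N + 1) (Set.powersetCard.ofFinEmbEquiv k') := by
    rw [exteriorPower.basis_apply, exteriorPower.ιMulti_family, Equiv.symm_apply_apply, Fwedge]
    congr 1
    funext a
    rw [Function.comp_apply, symBasis, Module.Basis.mk_apply]
    rfl
  rw [e1, e2, ← Module.Basis.tensorProduct_apply, phi, Module.Basis.constr_basis]
  simp only [Equiv.symm_apply_apply]
  rfl

end Phi

end Plethysm

end

/-!
Read elements of `Sym^c E` as forms on `R`-valued points of `E`, and elements of `⋀^r Sym^c E` as
alternating forms in `r` points. With `⟨q, p⟩` the bracket of two points, summing the box as a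
product of geometric series shows that `φ (g ⊗ f)` is the form
`(p₁, …, p_N; q) ↦ g(q) f(q, p₁, …, p_N) / ∏ ⟨q, p_a⟩`.
* Brackets scale by `det` under a linear map, so `φ` is equivariant up to `det ^ N`.
* Antisymmetrising this form over `N + 1` points of the affine line gives `f` times the divided
  difference at `N + 1` nodes of the polynomial `g`, which has degree less than `N`, so it is zero.
* If `φ x = 0`, the polynomial in `q` attached to `x` has degree less than `N` and vanishes at
  `N + 1` generic points, so `x = 0`; the source and `Δ^(2,1^(N-1)) Sym^d E` have equal dimension.
-/

namespace Plethysm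

section Determinant

variable {R : Type*} [CommRing R] {N : ℕ}

theorem prod_mul_det_eq_mul_det (A : Matrix (Fin (N + 1)) (Fin (N + 1)) R) (c e : Fin N → R)
    (h : ∀ i, c i * A i.succ 0 = e i * A i.castSucc 0) :
    (∏ i, c i) * A.det = A 0 0 * (Matrix.of fun i a : Fin N =>
      c i * A i.succ a.succ - e i * A i.castSucc a.succ).det := by
  let L : Matrix (Fin (N + 1)) (Fin (N + 1)) R := Matrix.of <| Fin.cons (Pi.single 0 1)
    fun i => Pi.single i.succ (c i) - Pi.single i.castSucc (e i)
  have hL : L.det = ∏ i, c i := by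
    rw [Matrix.det_of_isLowerTriangular, Fin.prod_univ_succ]
    · simp [L, Fin.castSucc_lt_succ.ne']
    · intro i a (hia : i < a)
      cases i using Fin.cases with
      | zero => simp [L, hia.ne']
      | succ i => simp [L, hia.ne', (i.castSucc_lt_succ.trans hia).ne']
  have hzero (a) : (L * A) 0 a = A 0 a := by simp [L, Matrix.mul_apply, Pi.single_apply]
  have hsucc (i : Fin N) (a) : (L * A) i.succ a = c i * A i.succ a - e i * A i.castSucc a := by
    simp [L, Matrix.mul_apply, Pi.single_apply, sub_mul, Finset.sum_sub_distrib]
  rw [← hL, ← Matrix.det_mul, Matrix.det_succ_column_zero, Fin.sum_univ_succ, hzero,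
    Finset.sum_eq_zero fun i _ => by rw [hsucc, sub_eq_zero.2 (h i), mul_zero, zero_mul]]
  simp only [Fin.val_zero, pow_zero, one_mul, add_zero]
  congr 2
  ext i a
  simp [hsucc]

/-- The determinant of the monomials `x^(D - k_i) y^(k_i)` of degree `D` at the points
`(x_a, y_a)`. -/
noncomputable def monomialDet (D : ℕ) (k : Fin N → ℕ) (x y : Fin N → R) : R :=
  (Matrix.of fun i a => x a ^ (D - k i) * y a ^ k i).det

theorem map_monomialDet {S : Type*} [CommRing S] (φ : R →+* S) (D : ℕ) (k : Fin N → ℕ)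
    (x y : Fin N → R) :
    φ (monomialDet D k x y) = monomialDet D k (φ ∘ x) (φ ∘ y) := by
  simp only [monomialDet, RingHom.map_det]
  congr 1
  ext i a
  simp

/-- The matrix obtained from that of `monomialDet` by eliminating the first column and then the
first row. -/
def eliminationMatrix (D : ℕ) (k : Fin (N + 1) → ℕ) (x y : Fin (N + 1) → R) :
    Matrix (Fin N) (Fin N) R :=
  Matrix.of fun i a =>
    x 0 ^ (k i.succ - k i.castSucc) * (x a.succ ^ (D - k i.succ) * y a.succ ^ k i.succ) -
      y 0 ^ (k i.succ - k i.castSucc) *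
        (x a.succ ^ (D - k i.castSucc) * y a.succ ^ k i.castSucc)

theorem sum_succ_sub_castSucc {k : Fin (N + 1) → ℕ} (hk : Monotone k) :
    ∑ i : Fin N, (k i.succ - k i.castSucc) = k (Fin.last N) - k 0 := by
  have hle (i : Fin N) : k i.castSucc ≤ k i.succ := hk i.castSucc_lt_succ.le
  have hsum : ∑ i : Fin N, (k i.succ - k i.castSucc) + ∑ i : Fin N, k i.castSucc =
      ∑ i : Fin N, k i.succ := by
    rw [← Finset.sum_add_distrib]
    exact Finset.sum_congr rfl fun i _ => Nat.sub_add_cancel (hle i)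
  have := Fin.sum_univ_succ k
  have := Fin.sum_univ_castSucc k
  omega

theorem mul_det_eliminationMatrix_of_isLeftRegular {D : ℕ} {k : Fin (N + 1) → ℕ}
    (hk : Monotone k) (hD : ∀ i, k i ≤ D) {x : Fin (N + 1) → R} (hx : IsLeftRegular (x 0))
    (y : Fin (N + 1) → R) :
    x 0 ^ (D - k (Fin.last N)) * y 0 ^ k 0 * (eliminationMatrix D k x y).det =
      monomialDet D k x y := by
  have hle (i : Fin N) : k i.castSucc ≤ k i.succ := hk i.castSucc_lt_succ.le
  have helim := prod_mul_det_eq_mul_det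
    (Matrix.of fun i a => x a ^ (D - k i) * y a ^ k i)
    (fun i => x 0 ^ (k i.succ - k i.castSucc)) (fun i => y 0 ^ (k i.succ - k i.castSucc))
    fun i => by
      have := hD i.succ
      have := hle i
      simp only [Matrix.of_apply]
      rw [← mul_assoc, ← pow_add, mul_left_comm, ← pow_add]
      congr 2 <;> omega
  rw [Finset.prod_pow_eq_pow_sum, sum_succ_sub_castSucc hk] at helim
  refine hx.pow (k (Fin.last N) - k 0) (Eq.trans ?_ helim.symm)
  have := hD (Fin.last N)
  have := hk (Fin.zero_le (Fin.last N))
  change _ = x 0 ^ (D - k 0) * y 0 ^ k 0 * (eliminationMatrix D k x y).det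
  rw [show D - k 0 = (k (Fin.last N) - k 0) + (D - k (Fin.last N)) by omega, pow_add]
  ring

-- Specialised from the points `(X + x_a, y_a)` over `R[X]`, whose first coordinates are regular.
theorem mul_det_eliminationMatrix {D : ℕ} {k : Fin (N + 1) → ℕ} (hk : Monotone k)
    (hD : ∀ i, k i ≤ D) (x y : Fin (N + 1) → R) :
    x 0 ^ (D - k (Fin.last N)) * y 0 ^ k 0 * (eliminationMatrix D k x y).det =
      monomialDet D k x y := by
  have hgen := congrArg (Polynomial.evalRingHom 0) <|
    mul_det_eliminationMatrix_of_isLeftRegular hk hD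
      (x := fun a => Polynomial.X + Polynomial.C (x a))
      (Polynomial.monic_X_add_C (x 0)).isRegular.left (Polynomial.C ∘ y)
  rw [map_monomialDet, map_mul, RingHom.map_det] at hgen
  convert hgen using 2
  · simp
  · congr 1
    ext i a
    simp [eliminationMatrix]
  · ext a
    simp
  · ext a
    simp

theorem det_sum_piFinset {ι : Type*} (s : Fin N → Finset ι)
    (f : Fin N → ι → Fin N → R) :
    (Matrix.of fun r a => ∑ i ∈ s r, f r i a).det =
      ∑ i ∈ Fintype.piFinset s, (Matrix.of fun r a => f r (i r) a).det := by
  classical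
  have h := (Matrix.detRowAlternating (R := R) (n := Fin N)).toMultilinearMap.map_sum_finset f s
  refine Eq.trans (congrArg Matrix.det ?_) h
  ext r a
  simp

theorem sum_Ico_mul_bracket (x y x' y' : R) {d k l : ℕ} (hkl : k ≤ l) (hl : l ≤ d + 1) :
    (∑ i ∈ Finset.Ico k l, x ^ (i - k) * y ^ (l - 1 - i) * (x' ^ (d - i) * y' ^ i)) *
        (x * y' - y * x') =
      x ^ (l - k) * (x' ^ (d + 1 - l) * y' ^ l) - y ^ (l - k) * (x' ^ (d + 1 - k) * y' ^ k) := by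
  have htel := Finset.sum_Ico_sub
    (fun i => x ^ (i - k) * y ^ (l - i) * (x' ^ (d + 1 - i) * y' ^ i)) hkl
  simp only [Nat.sub_self, pow_zero, mul_one, one_mul] at htel
  rw [← htel, Finset.sum_mul]
  refine Finset.sum_congr rfl fun i hi => ?_
  obtain ⟨hki, hil⟩ := Finset.mem_Ico.1 hi
  rw [show i + 1 - k = i - k + 1 by omega, show d + 1 - (i + 1) = d - i by omega,
    show l - (i + 1) = l - 1 - i by omega, show d + 1 - i = d - i + 1 by omega,
    show l - i = l - 1 - i + 1 by omega]
  ring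

end Determinant

section LinearForms

variable {k : Type*} [CommRing k] {R : Type*} [CommRing R] [Algebra k R]
  {S : Type*} [CommRing S] [Algebra k S]
  {V : Type*} [AddCommGroup V] [Module k V] {W : Type*} [AddCommGroup W] [Module k W]

/-- The linear form `v₁ ∧ ⋯ ∧ v_r ↦ det (p_a (v_i))` on `⋀^r V` attached to linear maps
`p₁, …, p_r : V → R`. -/
noncomputable def wedgeEval {r : ℕ} (p : Fin r → V →ₗ[k] R) : ⋀[k]^r V →ₗ[k] R :=
  exteriorPower.alternatingMapLinearEquiv <| MultilinearMap.alternatization <|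
    (MultilinearMap.mkPiAlgebra k (Fin r) R).compLinearMap p

theorem wedgeEval_ιMulti {r : ℕ} (p : Fin r → V →ₗ[k] R) (v : Fin r → V) :
    wedgeEval p (exteriorPower.ιMulti k r v) = (Matrix.of fun i a => p a (v i)).det := by
  simp [wedgeEval, MultilinearMap.alternatization_apply, Matrix.det_apply]

theorem wedgeEval_comp_map {r : ℕ} (p : Fin r → W →ₗ[k] R) (f : V →ₗ[k] W) :
    wedgeEval p ∘ₗ exteriorPower.map r f = wedgeEval fun a => p a ∘ₗ f := by
  ext v
  simp [wedgeEval_ιMulti, exteriorPower.map_apply_ιMulti]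

theorem comp_wedgeEval (φ : R →ₐ[k] S) {r : ℕ} (p : Fin r → V →ₗ[k] R) :
    φ.toLinearMap ∘ₗ wedgeEval p = wedgeEval fun a => φ.toLinearMap ∘ₗ p a := by
  ext v
  simp only [LinearMap.compAlternatingMap_apply, wedgeEval_ιMulti, LinearMap.comp_apply,
    AlgHom.toLinearMap_apply, AlgHom.map_det]
  rfl

theorem wedgeEval_perm {r : ℕ} (p : Fin r → V →ₗ[k] R) (σ : Equiv.Perm (Fin r)) :
    (wedgeEval fun a => p (σ a)) = ((Equiv.Perm.sign σ : ℤ) : R) • wedgeEval p := by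
  ext v
  simp only [LinearMap.compAlternatingMap_apply, wedgeEval_ιMulti, LinearMap.smul_apply,
    smul_eq_mul]
  exact Matrix.det_permute' σ (Matrix.of fun i a => p a (v i))

/-- The product form `x ⊗ y ↦ f x * g y` on `V ⊗ W` of two `R`-valued linear forms. -/
noncomputable def tensorEval (f : V →ₗ[k] R) (g : W →ₗ[k] R) : V ⊗[k] W →ₗ[k] R :=
  LinearMap.mul' k R ∘ₗ TensorProduct.map f g

@[simp]
theorem tensorEval_tmul (f : V →ₗ[k] R) (g : W →ₗ[k] R) (x : V) (y : W) :
    tensorEval f g (x ⊗ₜ[k] y) = f x * g y := by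
  simp [tensorEval]

theorem tensorEval_smul_right (f : V →ₗ[k] R) (g : W →ₗ[k] R) (c : R) (x : V ⊗[k] W) :
    tensorEval f (c • g) x = c * tensorEval f g x := by
  have h : tensorEval f (c • g) = c • tensorEval f g :=
    TensorProduct.ext' fun v w => by simp [mul_left_comm]
  rw [h, LinearMap.smul_apply, smul_eq_mul]

theorem tensorEval_map {V' W' : Type*} [AddCommGroup V'] [Module k V'] [AddCommGroup W']
    [Module k W'] (f : V' →ₗ[k] R) (g : W' →ₗ[k] R) (f' : V →ₗ[k] V') (g' : W →ₗ[k] W')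
    (x : V ⊗[k] W) :
    tensorEval f g (TensorProduct.map f' g' x) = tensorEval (f ∘ₗ f') (g ∘ₗ g') x := by
  rw [tensorEval, tensorEval, TensorProduct.map_comp]
  rfl

theorem tensorEval_comm (f : V →ₗ[k] R) (g : W →ₗ[k] R) (x : V ⊗[k] W) :
    tensorEval g f (TensorProduct.comm k V W x) = tensorEval f g x := by
  have h : tensorEval g f ∘ₗ (TensorProduct.comm k V W).toLinearMap = tensorEval f g :=
    TensorProduct.ext' fun v w => by simp [mul_comm]
  exact LinearMap.congr_fun h x

theorem comp_tensorEval (φ : R →ₐ[k] S) (f : V →ₗ[k] R) (g : W →ₗ[k] R) :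
    φ.toLinearMap ∘ₗ tensorEval f g = tensorEval (φ.toLinearMap ∘ₗ f) (φ.toLinearMap ∘ₗ g) :=
  TensorProduct.ext' fun v w => by simp

end LinearForms

section Evaluation

variable {F : Type*} [Field F] {R : Type*} [CommRing R] [Algebra F R]
  {S : Type*} [CommRing S] [Algebra F S]
  {E : Type*} [AddCommGroup E] [Module F E] {W : Type*} [AddCommGroup W] [Module F W]

/-- The value of an element of `Sym^c E`, seen as a homogeneous form of degree `c`, at an
`R`-valued point `p : E → R`: the linear map with `v₁ ⋯ v_c ↦ p v₁ ⋯ p v_c`. -/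
noncomputable def symEval (c : ℕ) (p : E →ₗ[F] R) : SymPow F c E →ₗ[F] R :=
  (SymmetricAlgebra.lift p).toLinearMap ∘ₗ (SymPow F c E).subtype

theorem symEval_monomial (b : Module.Basis (Fin 2) F E) (p : E →ₗ[F] R) {c i : ℕ} (h : i ≤ c) :
    symEval c p (monomial b c i) = p (b 0) ^ (c - i) * p (b 1) ^ i := by
  simp [symEval, monomial, h]

theorem symEval_comp_symMap (c : ℕ) (p : W →ₗ[F] R) (f : E →ₗ[F] W) :
    symEval c p ∘ₗ symMap c f = symEval c (p ∘ₗ f) := by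
  have h : (SymmetricAlgebra.lift p).comp
      (SymmetricAlgebra.lift (SymmetricAlgebra.ι F W ∘ₗ f)) = SymmetricAlgebra.lift (p ∘ₗ f) := by
    ext v; simp
  exact LinearMap.ext fun x => AlgHom.congr_fun h x.1

theorem comp_symEval (φ : R →ₐ[F] S) (c : ℕ) (p : E →ₗ[F] R) :
    φ.toLinearMap ∘ₗ symEval c p = symEval c (φ.toLinearMap ∘ₗ p) := by
  have h : φ.comp (SymmetricAlgebra.lift p) = SymmetricAlgebra.lift (φ.toLinearMap ∘ₗ p) := by
    ext v; simp
  exact LinearMap.ext fun x => AlgHom.congr_fun h x.1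

/-- Evaluation of an element of `⋀^r Sym^c E`, seen as an alternating form in `r` points of
degree `c` in each, at `p₁, …, p_r`. -/
noncomputable def wedgeSymEval {r : ℕ} (c : ℕ) (p : Fin r → E →ₗ[F] R) :
    ⋀[F]^r (SymPow F c E) →ₗ[F] R :=
  wedgeEval fun a => symEval c (p a)

theorem wedgeSymEval_Fwedge (b : Module.Basis (Fin 2) F E) {r c : ℕ} (p : Fin r → E →ₗ[F] R)
    {k : Fin r → ℕ} (hk : ∀ a, k a ≤ c) :
    wedgeSymEval c p (Fwedge b c k) =
      monomialDet c k (fun a => p a (b 0)) fun a => p a (b 1) := by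
  simp only [wedgeSymEval, Fwedge, wedgeEval_ιMulti, symEval_monomial b _ (hk _), monomialDet]

theorem wedgeSymEval_comp_map {r c : ℕ} (p : Fin r → W →ₗ[F] R) (f : E →ₗ[F] W) :
    wedgeSymEval c p ∘ₗ exteriorPower.map r (symMap c f) =
      wedgeSymEval c fun a => p a ∘ₗ f := by
  simp only [wedgeSymEval, wedgeEval_comp_map, symEval_comp_symMap]

theorem comp_wedgeSymEval (φ : R →ₐ[F] S) {r c : ℕ} (p : Fin r → E →ₗ[F] R) :
    φ.toLinearMap ∘ₗ wedgeSymEval c p = wedgeSymEval c fun a => φ.toLinearMap ∘ₗ p a := by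
  simp only [wedgeSymEval, comp_wedgeEval, comp_symEval]

end Evaluation

section Multiplication

variable {F : Type*} [Field F] {V : Type*} [AddCommGroup V] [Module F V]

theorem mu_ιMulti_tmul {N : ℕ} (v : Fin N → V) (u : V) :
    mu F V N (exteriorPower.ιMulti F N v ⊗ₜ[F] u) =
      exteriorPower.ιMulti F (N + 1) (Fin.snoc v u) := by
  apply Subtype.ext
  change ExteriorAlgebra.ιMulti F N v * ExteriorAlgebra.ι F u =
    ExteriorAlgebra.ιMulti F (N + 1) (Fin.snoc v u)
  simp only [ExteriorAlgebra.ιMulti_apply, List.ofFn_succ', List.concat_eq_append,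
    List.prod_append, Fin.snoc_castSucc, Fin.snoc_last, List.prod_singleton]

theorem mu_surjective (N : ℕ) : Function.Surjective (mu F V N) := by
  rw [← LinearMap.range_eq_top, eq_top_iff, ← exteriorPower.ιMulti_span, Submodule.span_le]
  rintro _ ⟨v, rfl⟩
  exact ⟨exteriorPower.ιMulti F N (Fin.init v) ⊗ₜ[F] v (Fin.last N), by
    rw [mu_ιMulti_tmul, Fin.snoc_init_self]⟩

theorem wedgeEval_mu {R : Type*} [CommRing R] [Algebra F R] {N : ℕ}
    (p : Fin (N + 1) → V →ₗ[F] R) (w : (⋀[F]^N V) ⊗[F] V) :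
    wedgeEval p (mu F V N w) = ∑ j : Fin (N + 1), (-1) ^ (N + j : ℕ) *
      tensorEval (wedgeEval fun a => p (j.succAbove a)) (p j) w := by
  suffices h : wedgeEval p ∘ₗ mu F V N = ∑ j : Fin (N + 1), ((-1) ^ (N + j : ℕ) : R) •
      tensorEval (wedgeEval fun a => p (j.succAbove a)) (p j) by
    simpa using LinearMap.congr_fun h w
  apply TensorProduct.ext
  ext v u
  simp only [LinearMap.compAlternatingMap_apply, LinearMap.compr₂ₛₗ_apply,
    TensorProduct.mk_apply, LinearMap.comp_apply, mu_ιMulti_tmul, wedgeEval_ιMulti,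
    LinearMap.sum_apply, LinearMap.smul_apply, tensorEval_tmul, smul_eq_mul]
  rw [Matrix.det_succ_row _ (Fin.last N)]
  refine Finset.sum_congr rfl fun j _ => ?_
  have hminor : (Matrix.of fun i a => p a ((Fin.snoc v u : Fin (N + 1) → V) i)).submatrix
      (Fin.last N).succAbove j.succAbove = Matrix.of fun i a => p (j.succAbove a) (v i) := by
    ext i a
    simp
  rw [hminor, Matrix.of_apply, Fin.snoc_last, Fin.val_last, mul_assoc, mul_comm (p j u)]

theorem finrank_Delta [Module.Finite F V] (N : ℕ) :
    (Module.finrank F V).choose (N + 1) + Module.finrank F (Delta F V N) =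
      (Module.finrank F V).choose N * Module.finrank F V := by
  have h := LinearMap.finrank_range_add_finrank_ker (V := (⋀[F]^N V) ⊗[F] V) (mu F V N)
  rwa [LinearMap.range_eq_top.2 (mu_surjective N), finrank_top, Module.finrank_tensorProduct,
    exteriorPower.finrank_eq, exteriorPower.finrank_eq] at h

end Multiplication

section Bracket

variable {F : Type*} [Field F] {R : Type*} [CommRing R] [Algebra F R]
  {E : Type*} [AddCommGroup E] [Module F E] (b : Module.Basis (Fin 2) F E)

/-- The bracket `p₀ q₁ - p₁ q₀` of two points `p` and `q`, in the coordinates given by `b`. -/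
noncomputable def bracket (p q : E →ₗ[F] R) : R :=
  p (b 0) * q (b 1) - p (b 1) * q (b 0)

theorem bracket_comp (p q : E →ₗ[F] R) (f : E →ₗ[F] E) :
    bracket b (p ∘ₗ f) (q ∘ₗ f) = algebraMap F R (LinearMap.det f) * bracket b p q := by
  have hf (j) : f (b j) =
      LinearMap.toMatrix b b f 0 j • b 0 + LinearMap.toMatrix b b f 1 j • b 1 := by
    conv_lhs => rw [← b.sum_repr (f (b j)), Fin.sum_univ_two]
    simp [LinearMap.toMatrix_apply]
  simp only [bracket, LinearMap.comp_apply]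
  rw [← LinearMap.det_toMatrix b, Matrix.det_fin_two, hf 0, hf 1]
  simp only [map_add, map_smul, map_sub, map_mul, Algebra.smul_def]
  ring

theorem pow_exponent_eq (x y : R) {N d s : ℕ} (hs : s + 1 ≤ N) {k : Fin (N + 1) → ℕ}
    (hd : ∀ a, k a ≤ d + 1) {i : Fin N → ℕ} (hi : i ∈ box k) :
    x ^ (d - (s + ∑ a, k a - N - ∑ a, i a)) * y ^ (s + ∑ a, k a - N - ∑ a, i a) =
      x ^ (N - 1 - s) * y ^ s * (x ^ (d + 1 - k (Fin.last N)) * y ^ k 0) *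
        ∏ a, (x ^ (i a - k a.castSucc) * y ^ (k a.succ - 1 - i a)) := by
  obtain ⟨-, hlow, hhigh⟩ := exponent_le hs hd hi
  simp only [box, Fintype.mem_piFinset, Finset.mem_Ico] at hi
  have hx : ∑ a, (i a - k a.castSucc) + ∑ a : Fin N, k a.castSucc = ∑ a, i a := by
    rw [← Finset.sum_add_distrib]
    exact Finset.sum_congr rfl fun a _ => Nat.sub_add_cancel (hi a).1
  have hy : ∑ a, (k a.succ - 1 - i a) + ∑ a, (i a + 1) = ∑ a : Fin N, k a.succ := by
    rw [← Finset.sum_add_distrib]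
    exact Finset.sum_congr rfl fun a _ => by have := (hi a).2; omega
  rw [Finset.sum_add_distrib, Fin.sum_const, smul_eq_mul, mul_one] at hy
  have hsucc := Fin.sum_univ_succ k
  have hcast := Fin.sum_univ_castSucc k
  have hlast := hd (Fin.last N)
  rw [Finset.prod_mul_distrib, Finset.prod_pow_eq_pow_sum, Finset.prod_pow_eq_pow_sum,
    show d - (s + ∑ a, k a - N - ∑ a, i a) = (N - 1 - s) + (d + 1 - k (Fin.last N)) +
      ∑ a, (i a - k a.castSucc) by omega,
    show s + ∑ a, k a - N - ∑ a, i a = s + k 0 + ∑ a, (k a.succ - 1 - i a) by omega]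
  ring

theorem tensorEval_phiValue {N d s : ℕ} (hs : s + 1 ≤ N) {k : Fin (N + 1) → ℕ}
    (hd : ∀ a, k a ≤ d + 1) (p : Fin N → E →ₗ[F] R) (q : E →ₗ[F] R) :
    tensorEval (wedgeSymEval d p) (symEval d q) (phiValue b N d s k) =
      q (b 0) ^ (N - 1 - s) * q (b 1) ^ s *
        (q (b 0) ^ (d + 1 - k (Fin.last N)) * q (b 1) ^ k 0) *
        (Matrix.of fun r a : Fin N => ∑ i ∈ Finset.Ico (k r.castSucc) (k r.succ),
          q (b 0) ^ (i - k r.castSucc) * q (b 1) ^ (k r.succ - 1 - i) *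
            (p a (b 0) ^ (d - i) * p a (b 1) ^ i)).det := by
  rw [det_sum_piFinset, phiValue, map_sum, Finset.mul_sum]
  refine Finset.sum_congr rfl fun i hi => ?_
  obtain ⟨hid, -, hjd⟩ := exponent_le hs hd hi
  have hscale := Matrix.det_mul_column
    (fun r => q (b 0) ^ (i r - k r.castSucc) * q (b 1) ^ (k r.succ - 1 - i r))
    (Matrix.of fun r a : Fin N => p a (b 0) ^ (d - i r) * p a (b 1) ^ i r)
  simp only [Matrix.of_apply] at hscale
  rw [hscale, Ftensor, tensorEval_tmul, symEval_monomial b q hjd, wedgeSymEval_Fwedge b p hid,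
    pow_exponent_eq _ _ hs hd hi, monomialDet]
  ring

theorem tensorEval_phiValue_mul_prod_bracket {N d s : ℕ} (hs : s + 1 ≤ N)
    {k : Fin (N + 1) → ℕ} (hk : Monotone k) (hd : ∀ a, k a ≤ d + 1)
    (p : Fin (N + 1) → E →ₗ[F] R) :
    tensorEval (wedgeSymEval d fun a => p a.succ) (symEval d (p 0)) (phiValue b N d s k) *
        ∏ a : Fin N, bracket b (p 0) (p a.succ) =
      symEval (N - 1) (p 0) (monomial b (N - 1) s) *
        wedgeSymEval (d + 1) p (Fwedge b (d + 1) k) := by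
  rw [tensorEval_phiValue b hs hd, wedgeSymEval_Fwedge b p hd, symEval_monomial b _ (by omega),
    ← mul_det_eliminationMatrix hk hd, mul_assoc, mul_comm (Matrix.det _), ← Matrix.det_mul_row]
  rw [mul_assoc]
  congr 3
  ext r a
  simp only [Matrix.of_apply, eliminationMatrix]
  rw [mul_comm, bracket, sum_Ico_mul_bracket _ _ _ _ (hk r.castSucc_lt_succ.le) (hd _)]

theorem symBasis_apply (c : ℕ) (i : Fin (c + 1)) : symBasis b c i = monomial b c i := by
  rw [symBasis, Module.Basis.mk_apply]

theorem exteriorPower_symBasis_apply (c r : ℕ) (K : Set.powersetCard (Fin (c + 1)) r) :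
    (symBasis b c).exteriorPower r K =
      Fwedge b c fun a => (Set.powersetCard.ofFinEmbEquiv.symm K a : ℕ) := by
  rw [exteriorPower.basis_apply, exteriorPower.ιMulti_family, Fwedge]
  congr 1
  funext a
  rw [Function.comp_apply, symBasis_apply]

theorem linearMap_ext_monomial_tmul_Fwedge {c e r : ℕ} {M : Type*} [AddCommGroup M] [Module F M]
    {f g : (SymPow F c E) ⊗[F] (⋀[F]^r (SymPow F e E)) →ₗ[F] M}
    (h : ∀ (s : ℕ) (k : Fin r → ℕ), s ≤ c → StrictMono k → (∀ a, k a ≤ e) →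
      f (monomial b c s ⊗ₜ[F] Fwedge b e k) = g (monomial b c s ⊗ₜ[F] Fwedge b e k)) :
    f = g := by
  refine TensorProduct.ext ((symBasis b c).ext fun s => ((symBasis b e).exteriorPower r).ext
    fun K => ?_)
  rw [symBasis_apply, exteriorPower_symBasis_apply]
  exact h s _ (Nat.lt_succ_iff.1 s.2)
    (fun _ _ h => (Set.powersetCard.ofFinEmbEquiv.symm K).strictMono h)
    (fun a => Nat.lt_succ_iff.1 (Set.powersetCard.ofFinEmbEquiv.symm K a).2)

theorem tensorEval_phi_mul_prod_bracket {N d : ℕ} (hN : 1 ≤ N) (p : Fin (N + 1) → E →ₗ[F] R)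
    (x : (SymPow F (N - 1) E) ⊗[F] (⋀[F]^(N + 1) (SymPow F (d + 1) E))) :
    tensorEval (wedgeSymEval d fun a => p a.succ) (symEval d (p 0)) (phi b N d x) *
        ∏ a : Fin N, bracket b (p 0) (p a.succ) =
      tensorEval (symEval (N - 1) (p 0)) (wedgeSymEval (d + 1) p) x := by
  suffices h : LinearMap.mulRight F (∏ a : Fin N, bracket b (p 0) (p a.succ)) ∘ₗ
      tensorEval (wedgeSymEval d fun a => p a.succ) (symEval d (p 0)) ∘ₗ phi b N d =
      tensorEval (symEval (N - 1) (p 0)) (wedgeSymEval (d + 1) p) from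
    LinearMap.congr_fun h x
  refine linearMap_ext_monomial_tmul_Fwedge b fun s k hs hk hd => ?_
  have hval := tensorEval_phiValue_mul_prod_bracket b (by omega) hk.monotone hd p (s := s)
  rw [phiValue, ← phi_apply b hs hk hd] at hval
  rw [tensorEval_tmul, ← hval]
  rfl

theorem tensorEval_phi_mul_prod_bracket_succAbove {N d : ℕ} (hN : 1 ≤ N)
    (p : Fin (N + 1) → E →ₗ[F] R) (j : Fin (N + 1))
    (x : (SymPow F (N - 1) E) ⊗[F] (⋀[F]^(N + 1) (SymPow F (d + 1) E))) :
    tensorEval (wedgeSymEval d fun a => p (j.succAbove a)) (symEval d (p j)) (phi b N d x) *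
        ∏ a : Fin N, bracket b (p j) (p (j.succAbove a)) =
      (-1) ^ (j : ℕ) * tensorEval (symEval (N - 1) (p j)) (wedgeSymEval (d + 1) p) x := by
  have hperm : wedgeSymEval (d + 1) (fun a => p (j.cycleRange.symm a)) =
      ((-1) ^ (j : ℕ) : R) • wedgeSymEval (d + 1) p := by
    simp only [wedgeSymEval]
    rw [wedgeEval_perm (fun a => symEval (d + 1) (p a)), Equiv.Perm.sign_symm,
      Fin.sign_cycleRange]
    simp
  have h := tensorEval_phi_mul_prod_bracket b hN (fun a => p (j.cycleRange.symm a)) x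
  rw [hperm, tensorEval_smul_right] at h
  simpa only [Fin.cycleRange_symm_zero, Fin.cycleRange_symm_succ] using h

end Bracket

section GenericPoints

variable {F : Type*} [Field F] {R : Type*} [CommRing R] [Algebra F R]
  {E : Type*} [AddCommGroup E] [Module F E] (b : Module.Basis (Fin 2) F E)
  {V : Type*} [AddCommGroup V] [Module F V]

/-- The point `X ↦ 1`, `Y ↦ z` of the affine line inside the projective line. -/
noncomputable def affinePoint (z : R) : E →ₗ[F] R :=
  b.constr F ![1, z]

@[simp]
theorem affinePoint_apply_zero (z : R) : affinePoint b z (b 0) = 1 := by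
  simp [affinePoint]

@[simp]
theorem affinePoint_apply_one (z : R) : affinePoint b z (b 1) = z := by
  simp [affinePoint]

theorem comp_affinePoint {S : Type*} [CommRing S] [Algebra F S] (φ : R →ₐ[F] S) (z : R) :
    φ.toLinearMap ∘ₗ affinePoint b z = affinePoint b (φ z) := by
  refine b.ext fun i => ?_
  fin_cases i <;> simp

theorem bracket_affinePoint (z w : R) :
    bracket b (affinePoint b z) (affinePoint b w) = w - z := by
  simp [bracket]

theorem wedgeSymEval_affinePoint_Fwedge {r c : ℕ} (z : Fin r → R) {k : Fin r → ℕ}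
    (hk : ∀ a, k a ≤ c) :
    wedgeSymEval c (fun a => affinePoint b (z a)) (Fwedge b c k) =
      (Matrix.of fun i a => z a ^ k i).det := by
  simp [wedgeSymEval_Fwedge b _ hk, monomialDet]

theorem coeff_det_X_pow {r : ℕ} {k l : Fin r → ℕ} (hk : StrictMono k) (hl : StrictMono l) :
    MvPolynomial.coeff (Finsupp.equivFunOnFinite.symm l)
      (Matrix.of fun i a : Fin r => (MvPolynomial.X a : MvPolynomial (Fin r) R) ^ k i).det =
        if k = l then 1 else 0 := by
  have hterm (σ : Equiv.Perm (Fin r)) : ∏ a, (Matrix.of fun i a : Fin r =>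
      (MvPolynomial.X a : MvPolynomial (Fin r) R) ^ k i) (σ a) a =
        MvPolynomial.monomial (Finsupp.equivFunOnFinite.symm (k ∘ σ)) 1 := by
    rw [MvPolynomial.monomial_eq, Finsupp.prod_fintype _ _ (by simp)]
    simp
  have hperm (σ : Equiv.Perm (Fin r)) (h : k ∘ σ = l) : k = l ∧ σ = 1 := by
    have hkl : k = l := (hk.range_inj hl).1 (by rw [← h, EquivLike.range_comp])
    exact ⟨hkl, Equiv.ext fun a => hk.injective ((congrFun h a).trans (congrFun hkl a).symm)⟩
  rw [Matrix.det_apply, MvPolynomial.coeff_sum]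
  simp only [hterm, Units.smul_def, MvPolynomial.coeff_smul, MvPolynomial.coeff_monomial,
    EmbeddingLike.apply_eq_iff_eq]
  split_ifs with hkl
  · rw [Finset.sum_eq_single 1]
    · simp [hkl]
    · intro σ _ hne
      rw [if_neg fun h => hne (hperm σ h).2, smul_zero]
    · simp
  · refine Finset.sum_eq_zero fun σ _ => ?_
    rw [if_neg fun h => hkl (hperm σ h).1, smul_zero]

theorem coord_eq_lcoeff_comp_wedgeSymEval_X {c r : ℕ} (L : Set.powersetCard (Fin (c + 1)) r) :
    ((symBasis b c).exteriorPower r).coord L =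
      MvPolynomial.lcoeff F (Finsupp.equivFunOnFinite.symm fun a =>
        (Set.powersetCard.ofFinEmbEquiv.symm L a : ℕ)) ∘ₗ
      wedgeSymEval c fun a : Fin r =>
        affinePoint b (MvPolynomial.X a : MvPolynomial (Fin r) F) := by
  refine ((symBasis b c).exteriorPower r).ext fun K => ?_
  rw [Module.Basis.coord_apply, Module.Basis.repr_self, LinearMap.comp_apply,
    exteriorPower_symBasis_apply, wedgeSymEval_affinePoint_Fwedge b _
      fun a => Nat.lt_succ_iff.1 (Set.powersetCard.ofFinEmbEquiv.symm K a).2]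
  refine Eq.trans ?_ (coeff_det_X_pow
    (fun _ _ h => (Set.powersetCard.ofFinEmbEquiv.symm K).strictMono h)
    (fun _ _ h => (Set.powersetCard.ofFinEmbEquiv.symm L).strictMono h)).symm
  rw [Finsupp.single_apply]
  refine if_congr ⟨fun h => by rw [h], fun h => ?_⟩ rfl rfl
  exact Set.powersetCard.ofFinEmbEquiv.symm.injective
    (DFunLike.ext _ _ fun a => Fin.ext (congrFun h a))

theorem wedgeSymEval_X_injective (c r : ℕ) :
    Function.Injective (wedgeSymEval c fun a : Fin r =>
      affinePoint b (MvPolynomial.X a : MvPolynomial (Fin r) F)) := by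
  rw [injective_iff_map_eq_zero]
  intro w hw
  refine ((symBasis b c).exteriorPower r).forall_coord_eq_zero_iff.1 fun L => ?_
  rw [coord_eq_lcoeff_comp_wedgeSymEval_X, LinearMap.comp_apply, hw, map_zero]

theorem wedgeSymEval_affinePoint_injective (c : ℕ) {r : ℕ} {z : Fin r → R}
    (hz : AlgebraicIndependent F z) :
    Function.Injective (wedgeSymEval c fun a => affinePoint b (z a)) := by
  have h : (wedgeSymEval c fun a => affinePoint b (z a)) =
      (MvPolynomial.aeval z).toLinearMap ∘ₗ wedgeSymEval c fun a : Fin r =>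
        affinePoint b (MvPolynomial.X a : MvPolynomial (Fin r) F) := by
    simp only [comp_wedgeSymEval, comp_affinePoint, MvPolynomial.aeval_X]
  rw [h, LinearMap.coe_comp]
  exact Function.Injective.comp hz (wedgeSymEval_X_injective b c r)

/-- For an element of `Sym^c E ⊗ V` and a linear form `g` on `V`, the polynomial in one variable
obtained by evaluating the factor `Sym^c E` at the generic affine point and `V` at `g`. -/
noncomputable def slicePoly (c : ℕ) (g : V →ₗ[F] R) :
    (SymPow F c E) ⊗[F] V →ₗ[F] Polynomial R :=
  tensorEval (symEval c (affinePoint b Polynomial.X)) (Polynomial.CAlgHom.toLinearMap ∘ₗ g)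

theorem eval_slicePoly (c : ℕ) (g : V →ₗ[F] R) (x : (SymPow F c E) ⊗[F] V) (z : R) :
    (slicePoly b c g x).eval z = tensorEval (symEval c (affinePoint b z)) g x := by
  have h : ((Polynomial.aeval z).restrictScalars F).toLinearMap ∘ₗ slicePoly b c g =
      tensorEval (symEval c (affinePoint b z)) g := by
    rw [slicePoly, comp_tensorEval, comp_symEval, comp_affinePoint]
    congr 1
    · simp
    · ext v
      simp
  simpa [Polynomial.coe_aeval_eq_eval] using LinearMap.congr_fun h x

theorem slicePoly_eq_sum (c : ℕ) (g : V →ₗ[F] R) (x : (SymPow F c E) ⊗[F] V) :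
    slicePoly b c g x = ∑ s : Fin (c + 1), Polynomial.C
      (g (TensorProduct.equivFinsuppOfBasisLeft (symBasis b c) x s)) * Polynomial.X ^ (s : ℕ) := by
  induction x using TensorProduct.induction_on with
  | zero => simp
  | add x y hx hy =>
    simp only [map_add, Finsupp.add_apply, add_mul, Finset.sum_add_distrib, hx, hy]
  | tmul m v =>
    simp only [slicePoly, tensorEval_tmul]
    conv_lhs => rw [← (symBasis b c).sum_repr m, map_sum, Finset.sum_mul]
    refine Finset.sum_congr rfl fun s _ => ?_
    rw [map_smul, symBasis_apply, symEval_monomial b _ (Nat.lt_succ_iff.1 s.2)]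
    simp [Algebra.smul_def, Polynomial.algebraMap_apply]

theorem degree_slicePoly_lt (c : ℕ) (g : V →ₗ[F] R) (x : (SymPow F c E) ⊗[F] V) :
    (slicePoly b c g x).degree < (c + 1 : ℕ) := by
  rw [slicePoly_eq_sum]
  exact Polynomial.degree_sum_fin_lt _

theorem slicePoly_injective (c : ℕ) {g : V →ₗ[F] R} (hg : Function.Injective g) :
    Function.Injective (slicePoly b c g) := by
  rw [injective_iff_map_eq_zero]
  intro x hx
  refine (TensorProduct.equivFinsuppOfBasisLeft (symBasis b c)).map_eq_zero_iff.1
    (Finsupp.ext fun s => hg ?_)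
  have hcoeff := congrArg (Polynomial.coeff · (s : ℕ)) hx
  simpa [slicePoly_eq_sum, Polynomial.finsetSum_coeff, Polynomial.coeff_C_mul_X_pow,
    Fin.val_inj] using hcoeff

theorem tensorEval_symEval_X_injective (c : ℕ) {g : V →ₗ[F] R} (hg : Function.Injective g) :
    Function.Injective (tensorEval (Polynomial.CAlgHom.toLinearMap ∘ₗ g)
      (symEval c (affinePoint b (Polynomial.X : Polynomial R)))) := by
  intro x y hxy
  rw [← tensorEval_comm, ← tensorEval_comm _ _ y] at hxy
  exact (TensorProduct.comm F V (SymPow F c E)).injective (slicePoly_injective b c hg hxy)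

theorem tensorEval_wedgeSymEval_X_injective (c e : ℕ) {r : ℕ} {z : Fin r → R}
    (hz : AlgebraicIndependent F z) :
    Function.Injective (tensorEval (wedgeSymEval e fun a => affinePoint b (Polynomial.C (z a)))
      (symEval c (affinePoint b (Polynomial.X : Polynomial R)))) := by
  have hC : (wedgeSymEval e fun a => affinePoint b (Polynomial.C (z a))) =
      Polynomial.CAlgHom.toLinearMap ∘ₗ wedgeSymEval e fun a => affinePoint b (z a) := by
    simp only [comp_wedgeSymEval, comp_affinePoint, Polynomial.CAlgHom_apply]
  rw [hC]
  exact tensorEval_symEval_X_injective b c (wedgeSymEval_affinePoint_injective b e hz)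

end GenericPoints

section Lagrange

theorem prod_erase_eq_prod_succAbove {M : Type*} [CommMonoid M] {N : ℕ} (j : Fin (N + 1))
    (f : Fin (N + 1) → M) :
    ∏ i ∈ Finset.univ.erase j, f i = ∏ a : Fin N, f (j.succAbove a) := by
  rw [← Finset.compl_singleton, ← Fin.image_succAbove_univ,
    Finset.prod_image fun _ _ _ _ h => Fin.succAbove_right_injective h]

theorem sum_eval_div_prod_sub_eq_zero {K : Type*} [Field K] {N : ℕ} {z : Fin (N + 1) → K}
    (hz : Function.Injective z) {P : Polynomial K} (hP : P.degree < N) :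
    ∑ j, P.eval (z j) / ∏ a : Fin N, (z j - z (j.succAbove a)) = 0 := by
  have hcard : P.degree < (Finset.univ : Finset (Fin (N + 1))).card :=
    hP.trans (by simpa using Nat.cast_lt (α := WithBot ℕ).2 N.lt_succ_self)
  have hcoeff := Lagrange.coeff_eq_sum (s := Finset.univ) hz.injOn hcard
  rw [Finset.card_univ, Fintype.card_fin, Nat.add_sub_cancel,
    Polynomial.coeff_eq_zero_of_degree_lt hP] at hcoeff
  simpa only [prod_erase_eq_prod_succAbove] using hcoeff.symm

theorem sum_eq_zero_of_mul_prod_eq_eval {K : Type*} [Field K] {N : ℕ} {z : Fin (N + 1) → K}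
    (hz : Function.Injective z) {P : Polynomial K} (hP : P.degree < N) (T : Fin (N + 1) → K)
    (hT : ∀ j, T j * ∏ a, (z (j.succAbove a) - z j) = (-1) ^ (j : ℕ) * P.eval (z j)) :
    ∑ j : Fin (N + 1), (-1) ^ (N + j : ℕ) * T j = 0 := by
  rw [← sum_eval_div_prod_sub_eq_zero hz hP]
  refine Finset.sum_congr rfl fun j _ => ?_
  have hne : ∏ a, (z j - z (j.succAbove a)) ≠ 0 := Finset.prod_ne_zero_iff.2 fun a _ =>
    sub_ne_zero.2 (hz.ne (Fin.succAbove_ne j a).symm)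
  have hneg : ∏ a, (z (j.succAbove a) - z j) = (-1) ^ N * ∏ a, (z j - z (j.succAbove a)) := by
    simp_rw [← neg_sub (z j)]
    rw [Finset.prod_neg, Finset.card_univ, Fintype.card_fin]
  have hval := hT j
  rw [hneg] at hval
  have hsign : (-1 : K) ^ (j : ℕ) * (-1) ^ (j : ℕ) = 1 := by rw [← mul_pow]; simp
  rw [eq_div_iff hne, pow_add]
  linear_combination (-1) ^ (j : ℕ) * hval + P.eval (z j) * hsign

end Lagrange

section Isomorphism

variable {F : Type*} [Field F] {E : Type*} [AddCommGroup E] [Module F E]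
  (b : Module.Basis (Fin 2) F E)

section Equivariance

variable {R : Type*} [CommRing R] [Algebra F R]

theorem tensorEval_symEval_wedgeSymEval_map {c e r : ℕ} (f : E →ₗ[F] E) (q : E →ₗ[F] R)
    (p : Fin r → E →ₗ[F] R) (x : (SymPow F c E) ⊗[F] (⋀[F]^r (SymPow F e E))) :
    tensorEval (symEval c q) (wedgeSymEval e p)
        (TensorProduct.map (symMap c f) (exteriorPower.map r (symMap e f)) x) =
      tensorEval (symEval c (q ∘ₗ f)) (wedgeSymEval e fun a => p a ∘ₗ f) x := by
  refine (tensorEval_map _ _ _ _ x).trans ?_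
  rw [symEval_comp_symMap, wedgeSymEval_comp_map]

theorem tensorEval_wedgeSymEval_symEval_map {c e r : ℕ} (f : E →ₗ[F] E)
    (p : Fin r → E →ₗ[F] R) (q : E →ₗ[F] R) (x : (⋀[F]^r (SymPow F e E)) ⊗[F] (SymPow F c E)) :
    tensorEval (wedgeSymEval e p) (symEval c q)
        (TensorProduct.map (exteriorPower.map r (symMap e f)) (symMap c f) x) =
      tensorEval (wedgeSymEval e fun a => p a ∘ₗ f) (symEval c (q ∘ₗ f)) x := by
  refine (tensorEval_map _ _ _ _ x).trans ?_
  rw [symEval_comp_symMap, wedgeSymEval_comp_map]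

theorem prod_bracket_comp {N : ℕ} (f : E →ₗ[F] E) (p : Fin (N + 1) → E →ₗ[F] R) :
    ∏ a : Fin N, bracket b (p 0 ∘ₗ f) (p a.succ ∘ₗ f) =
      algebraMap F R (LinearMap.det f ^ N) * ∏ a : Fin N, bracket b (p 0) (p a.succ) := by
  simp [bracket_comp, Finset.prod_mul_distrib]

theorem tensorEval_phi_map_mul_prod_bracket {N d : ℕ} (hN : 1 ≤ N) (f : E →ₗ[F] E)
    (p : Fin (N + 1) → E →ₗ[F] R)
    (x : (SymPow F (N - 1) E) ⊗[F] (⋀[F]^(N + 1) (SymPow F (d + 1) E))) :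
    tensorEval (wedgeSymEval d fun a => p a.succ) (symEval d (p 0))
        (phi b N d (TensorProduct.map (symMap (N - 1) f)
          (exteriorPower.map (N + 1) (symMap (d + 1) f)) x)) *
        ∏ a : Fin N, bracket b (p 0) (p a.succ) =
      algebraMap F R (LinearMap.det f ^ N) *
        tensorEval (wedgeSymEval d fun a => p a.succ) (symEval d (p 0))
          (TensorProduct.map (exteriorPower.map N (symMap d f)) (symMap d f) (phi b N d x)) *
        ∏ a : Fin N, bracket b (p 0) (p a.succ) := by
  have hcomp := tensorEval_phi_mul_prod_bracket b hN (fun a => p a ∘ₗ f) x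
  rw [prod_bracket_comp] at hcomp
  have hcomm (s t c : R) : s * (c * t) = c * s * t := by ring
  refine (tensorEval_phi_mul_prod_bracket b hN p _).trans
    ((tensorEval_symEval_wedgeSymEval_map f _ _ x).trans (hcomp.symm.trans ?_))
  refine (hcomm _ _ _).trans (congrArg (fun t => algebraMap F R (LinearMap.det f ^ N) * t *
    ∏ a : Fin N, bracket b (p 0) (p a.succ)) ?_)
  exact (tensorEval_wedgeSymEval_symEval_map f (fun a => p a.succ) (p 0) (phi b N d x)).symm

end Equivariance

theorem phi_map {N d : ℕ} (hN : 1 ≤ N) (f : E →ₗ[F] E)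
    (x : (SymPow F (N - 1) E) ⊗[F] (⋀[F]^(N + 1) (SymPow F (d + 1) E))) :
    phi b N d (TensorProduct.map (symMap (N - 1) f)
        (exteriorPower.map (N + 1) (symMap (d + 1) f)) x) =
      LinearMap.det f ^ N • TensorProduct.map (exteriorPower.map N (symMap d f)) (symMap d f)
        (phi b N d x) := by
  have key := tensorEval_phi_map_mul_prod_bracket b hN f
    (Fin.cons (affinePoint b Polynomial.X) fun a =>
      affinePoint b (Polynomial.C (MvPolynomial.X a : MvPolynomial (Fin N) F))) x
  simp only [Fin.cons_zero, Fin.cons_succ, bracket_affinePoint] at key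
  apply tensorEval_wedgeSymEval_X_injective b d d (MvPolynomial.algebraicIndependent_X (Fin N) F)
  rw [map_smul, Algebra.smul_def]
  refine mul_right_cancel₀ (Finset.prod_ne_zero_iff.2 fun a _ => ?_) key
  exact sub_ne_zero.2 (Polynomial.X_ne_C _).symm

theorem tensorEval_phi_mul_prod_sub {R : Type*} [CommRing R] [Algebra F R] {N d : ℕ} (hN : 1 ≤ N)
    (z : Fin (N + 1) → R) (j : Fin (N + 1))
    (x : (SymPow F (N - 1) E) ⊗[F] (⋀[F]^(N + 1) (SymPow F (d + 1) E))) :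
    tensorEval (wedgeSymEval d fun a => affinePoint b (z (j.succAbove a)))
        (symEval d (affinePoint b (z j))) (phi b N d x) * ∏ a, (z (j.succAbove a) - z j) =
      (-1) ^ (j : ℕ) * (slicePoly b (N - 1)
        (wedgeSymEval (d + 1) fun a => affinePoint b (z a)) x).eval (z j) := by
  rw [eval_slicePoly]
  simpa only [bracket_affinePoint] using
    tensorEval_phi_mul_prod_bracket_succAbove b hN (fun a => affinePoint b (z a)) j x

theorem wedgeSymEval_mu_phi {K : Type*} [Field K] [Algebra F K] {N d : ℕ} (hN : 1 ≤ N)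
    {z : Fin (N + 1) → K} (hz : Function.Injective z)
    (x : (SymPow F (N - 1) E) ⊗[F] (⋀[F]^(N + 1) (SymPow F (d + 1) E))) :
    wedgeSymEval d (fun a => affinePoint b (z a)) (mu F _ N (phi b N d x)) = 0 := by
  have hdeg := degree_slicePoly_lt b (N - 1)
    (wedgeSymEval (d + 1) fun a => affinePoint b (z a)) x
  rw [Nat.sub_add_cancel hN] at hdeg
  rw [wedgeSymEval, wedgeEval_mu]
  exact sum_eq_zero_of_mul_prod_eq_eval hz hdeg _ fun j => tensorEval_phi_mul_prod_sub b hN z j x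

theorem algebraicIndependent_algebraMap_X (R : Type*) [CommRing R] [IsDomain R] (ι : Type*) :
    AlgebraicIndependent R fun i : ι =>
      algebraMap (MvPolynomial ι R) (FractionRing (MvPolynomial ι R)) (MvPolynomial.X i) :=
  (MvPolynomial.algebraicIndependent_X ι R).map'
    (f := IsScalarTower.toAlgHom R (MvPolynomial ι R) (FractionRing (MvPolynomial ι R)))
    (IsFractionRing.injective _ _)

theorem phi_mem_Delta {N d : ℕ} (hN : 1 ≤ N)
    (x : (SymPow F (N - 1) E) ⊗[F] (⋀[F]^(N + 1) (SymPow F (d + 1) E))) :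
    phi b N d x ∈ Delta F (SymPow F d E) N := by
  have hz := algebraicIndependent_algebraMap_X F (Fin (N + 1))
  refine wedgeSymEval_affinePoint_injective b d hz ?_
  rw [wedgeSymEval_mu_phi b hN hz.injective, map_zero]

theorem phi_injective {N d : ℕ} (hN : 1 ≤ N) : Function.Injective (phi b N d) := by
  rw [injective_iff_map_eq_zero]
  intro x hx
  let z : Fin (N + 1) → MvPolynomial (Fin (N + 1)) F := MvPolynomial.X
  have hz : AlgebraicIndependent F z := MvPolynomial.algebraicIndependent_X _ F
  have hinj := slicePoly_injective b (N - 1) (wedgeSymEval_affinePoint_injective b (d + 1) hz)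
  rw [← hinj.eq_iff, map_zero]
  refine Polynomial.eq_zero_of_degree_lt_of_eval_index_eq_zero (v := z) Finset.univ
    hz.injective.injOn ((degree_slicePoly_lt b (N - 1) _ x).trans ?_) fun j _ => ?_
  · rw [Finset.card_univ, Fintype.card_fin]
    exact Nat.cast_lt.2 (by omega)
  · have hval := tensorEval_phi_mul_prod_sub b hN z j x
    rw [hx, map_zero, zero_mul] at hval
    exact (mul_eq_zero.1 hval.symm).resolve_left (pow_ne_zero _ (neg_ne_zero.2 one_ne_zero))

end Isomorphism

section Dimension

variable {F : Type*} [Field F] {E : Type*} [AddCommGroup E] [Module F E]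
  (b : Module.Basis (Fin 2) F E)

include b in
theorem finrank_symPow (c : ℕ) : Module.finrank F (SymPow F c E) = c + 1 := by
  rw [Module.finrank_eq_card_basis (symBasis b c), Fintype.card_fin]

theorem mul_choose_add_choose (N d : ℕ) :
    N * (d + 1).choose (N + 1) + d.choose (N + 1) = d.choose N * d := by
  have hsucc := Nat.choose_succ_right_eq d N
  rw [Nat.choose_succ_succ]
  obtain hle | hlt := le_or_gt N d
  · obtain ⟨e, rfl⟩ := Nat.exists_eq_add_of_le hle
    rw [Nat.add_sub_cancel_left] at hsucc
    linear_combination hsucc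
  · rw [Nat.choose_eq_zero_of_lt hlt, Nat.choose_eq_zero_of_lt (Nat.lt_succ_of_lt hlt)]
    simp

include b in
theorem finrank_symPow_tensor_exteriorPower {N d : ℕ} (hN : 1 ≤ N) :
    Module.finrank F ((SymPow F (N - 1) E) ⊗[F] (⋀[F]^(N + 1) (SymPow F (d + 1) E))) =
      Module.finrank F (Delta F (SymPow F d E) N) := by
  have (c : ℕ) : Module.Finite F (SymPow F c E) := Module.Finite.of_basis (symBasis b c)
  have hDelta := finrank_Delta (F := F) (V := SymPow F d E) N
  rw [finrank_symPow b, ← mul_choose_add_choose] at hDelta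
  rw [Module.finrank_tensorProduct, exteriorPower.finrank_eq, finrank_symPow b, finrank_symPow b,
    Nat.sub_add_cancel hN]
  omega

-- Stated for additive monoids because `Delta` is a submodule of a tensor product, which carries
-- the `AddCommMonoid` structure only.
theorem finite_submodule {R A : Type*} [Ring R] [IsNoetherianRing R] [AddCommMonoid A] [Module R A]
    [Module.Finite R A] (S : Submodule R A) : Module.Finite R S := by
  let _ := Module.addCommMonoidToAddCommGroup R (M := A)
  infer_instance

theorem bijective_of_injective_of_finrank_eq {K A B : Type*} [DivisionRing K] [AddCommMonoid A]
    [Module K A] [AddCommMonoid B] [Module K B] [Module.Finite K B] {f : A →ₗ[K] B}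
    (hf : Function.Injective f) (h : Module.finrank K A = Module.finrank K B) :
    Function.Bijective f := by
  let _ := Module.addCommMonoidToAddCommGroup K (M := A)
  let _ := Module.addCommMonoidToAddCommGroup K (M := B)
  exact (LinearEquiv.ofInjectiveOfFinrankEq f hf h).bijective

/-- The map `φ` as a linear isomorphism onto `Δ^(2,1^(N-1)) Sym^d E`. -/
noncomputable def phiEquiv {N : ℕ} (d : ℕ) (hN : 1 ≤ N) :
    (SymPow F (N - 1) E) ⊗[F] (⋀[F]^(N + 1) (SymPow F (d + 1) E)) ≃ₗ[F]
      Delta F (SymPow F d E) N :=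
  LinearEquiv.ofBijective
    ((phi b N d).codRestrict (Delta F (SymPow F d E) N) (phi_mem_Delta b hN)) <| by
    have (c : ℕ) : Module.Finite F (SymPow F c E) := Module.Finite.of_basis (symBasis b c)
    have := finite_submodule (Delta F (SymPow F d E) N)
    exact bijective_of_injective_of_finrank_eq
      (fun _ _ h => phi_injective b hN (congrArg Subtype.val h))
      (finrank_symPow_tensor_exteriorPower b hN)

end Dimension

section Representations

variable {F : Type*} [Field F] {G : Type*} [Monoid G]

/-- A linear isomorphism that is equivariant up to the scalars by which a one-dimensional
representation `χ` acts, as an isomorphism of representations `x ↦ 1 ⊗ e x` onto the twist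
by `χ`. -/
noncomputable def equivTprod {A B : Type*} [AddCommMonoid A] [Module F A] [AddCommMonoid B]
    [Module F B] {ρ : Representation F G A} {τ : Representation F G B}
    (χ : Representation F G F) (e : A ≃ₗ[F] B) (he : ∀ g x, e (ρ g x) = χ g 1 • τ g (e x)) :
    Representation.Equiv ρ (χ.tprod τ) :=
  Representation.Equiv.mk (e.trans (TensorProduct.lid F B).symm) fun g => LinearMap.ext fun x =>
    show (1 : F) ⊗ₜ[F] e (ρ g x) = TensorProduct.map (χ g) (τ g) (1 ⊗ₜ[F] e x) by
      rw [he, TensorProduct.tmul_smul, TensorProduct.smul_tmul', smul_eq_mul, mul_one,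
        TensorProduct.map_tmul]

theorem detRep_apply_one (N : ℕ) (g : GL (Fin 2) F) :
    detRep F N g 1 = LinearMap.det (natRep F g) ^ N :=
  (mul_one _).trans (congrArg (· ^ N) (LinearMap.det_toLin' (g : Matrix (Fin 2) (Fin 2) F)).symm)

end Representations

end Plethysm

theorem corollary3p1_general {F : Type*} [Field F] {E : Type*} [AddCommGroup E] [Module F E]
    (b : Module.Basis (Fin 2) F E) {G : Type*} [Monoid G] (ρ : Representation F G E)
    {N : ℕ} (d : ℕ) (hN : 1 ≤ N) (χ : Representation F G F)
    (hχ : ∀ g, χ g 1 = LinearMap.det (ρ g) ^ N) :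
    ∃ h : ∀ x, Plethysm.phi b N d x ∈ Plethysm.Delta F (Plethysm.SymPow F d E) N,
      ∃ Φ : Representation.Equiv
          ((Plethysm.symRep (N - 1) ρ).tprod
            (Plethysm.extRep (N + 1) (Plethysm.symRep (d + 1) ρ)))
          (χ.tprod (Plethysm.deltaRep N (Plethysm.symRep d ρ))),
        ∀ x, Φ x = (1 : F) ⊗ₜ[F] ⟨Plethysm.phi b N d x, h x⟩ := by
  have hequiv (g : G) (x) : Plethysm.phiEquiv b d hN
      (((Plethysm.symRep (N - 1) ρ).tprod
        (Plethysm.extRep (N + 1) (Plethysm.symRep (d + 1) ρ))) g x) =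
      χ g 1 • Plethysm.deltaRep N (Plethysm.symRep d ρ) g (Plethysm.phiEquiv b d hN x) :=
    Subtype.ext ((Plethysm.phi_map b hN (ρ g) x).trans (congrArg (· • _) (hχ g).symm))
  exact ⟨Plethysm.phi_mem_Delta b hN,
    Plethysm.equivTprod χ (Plethysm.phiEquiv b d hN) hequiv, fun _ => rfl⟩

theorem corollary3p1 {F : Type*} [Field F] (b : Module.Basis (Fin 2) F (Fin 2 → F))
    (N d : ℕ) (hN : 1 ≤ N) :
    ∃ h : ∀ x, Plethysm.phi b N d x ∈ Plethysm.Delta F (Plethysm.SymPow F d (Fin 2 → F)) N,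
      ∃ Φ : Representation.Equiv
          ((Plethysm.symRep (N - 1) (Plethysm.natRep F)).tprod
            (Plethysm.extRep (N + 1) (Plethysm.symRep (d + 1) (Plethysm.natRep F))))
          ((Plethysm.detRep F N).tprod
            (Plethysm.deltaRep N (Plethysm.symRep d (Plethysm.natRep F)))),
        ∀ x, Φ x = (1 : F) ⊗ₜ[F] ⟨Plethysm.phi b N d x, h x⟩ := by
  exact corollary3p1_general b (Plethysm.natRep F) d hN (Plethysm.detRep F N)
    (Plethysm.detRep_apply_one N)
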